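/- Let $\mathcal H$ be a complex Hilbert space, $U$ a unitary operator on $\mathcal H$, and let $m\ge k\ge 1$ be integers. Let $\alpha:\{1,\dots,m\}\to\{1,\dots,k\}$ be a partition of $\{1,\dots,m\}$ into $k$ parts, that is, a surjective map, and let $A_1,\dots,A_{m-1}$ be compact operators on $\mathcal H$. Then, as $N\to+\infty$, the ergodic average $$\frac{1}{N^{k}}\sum_{n_{1},\dots,n_{k}=0}^{N-1}U^{n_{\alpha(1)}}A_{1}U^{n_{\alpha(2)}}\cdots U^{n_{\alpha(m-1)}}A_{m-1}U^{n_{\alpha(m)}}$$ (for $m=1$, read as $\frac1N\sum_{n=0}^{N-1}U^{n}$) converges in the weak operator topology to some bounded operator $S_{\alpha;A_1,\dots,A_{m-1}}$ on $\mathcal H$. -/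

import Mathlib

open Filter
open scoped Topology

/-- The word `U ^ n_{α(1)} A_1 U ^ n_{α(2)} A_2 ⋯ A_{m-1} U ^ n_{α(m)}`, where `m = r + 1`, so that
there are `r` operators `A_j`. The index sets `{1, …, m}`, `{1, …, k}` and `{1, …, m - 1}` are
`Fin (r + 1)`, `Fin k` and `Fin r`. -/
def entangledWord {H : Type*} [NormedAddCommGroup H] [InnerProductSpace ℂ H]
    {r k : ℕ} (U : H →L[ℂ] H) (α : Fin (r + 1) → Fin k) (A : Fin r → H →L[ℂ] H)
    (n : Fin k → ℕ) : H →L[ℂ] H :=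
  U ^ n (α 0) * (List.ofFn fun j : Fin r => A j * U ^ n (α j.succ)).prod

/-- The entangled ergodic average: `N ^ (-k)` times the sum of the words over all
`(n_1, …, n_k)` in `{0, …, N - 1} ^ k`. -/
noncomputable def entangledMean {H : Type*} [NormedAddCommGroup H] [InnerProductSpace ℂ H]
    {r k : ℕ} (U : H →L[ℂ] H) (α : Fin (r + 1) → Fin k) (A : Fin r → H →L[ℂ] H)
    (N : ℕ) : H →L[ℂ] H :=
  ((N : ℂ) ^ k)⁻¹ • ∑ n : Fin k → Fin N, entangledWord U α A fun i => (n i : ℕ)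

open scoped InnerProductSpace TensorProduct
open InnerProductSpace (rankOne)

/-! ### Ergodic averages of matrix coefficients -/

section Coefficients

/-! The matrix coefficients of the entangled mean are multilinear in the `A j` and bounded uniformly
in `N`, and compact operators are norm limits of finite-rank ones, so one may take every `A j` of
rank one. The coefficient of a word then splits into scalars `⟪v, U ^ n_l u⟫`. Grouping them by the
blocks of `α` turns the mean into a product of `k` averages in one variable, each averaging a
coefficient of a tensor power of `U`, so von Neumann's mean ergodic theorem applies. A bounded
sesquilinear form then recovers the limit operator. -/

theorem ContinuousLinearMap.norm_pow_le_one {E : Type*} [SeminormedAddCommGroup E]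
    [NormedSpace ℂ E] {T : E →L[ℂ] E} (hT : ‖T‖ ≤ 1) (n : ℕ) : ‖T ^ n‖ ≤ 1 := by
  induction n with
  | zero => exact ContinuousLinearMap.norm_id_le
  | succ n ih =>
    rw [pow_succ]
    exact (ContinuousLinearMap.opNorm_comp_le _ _).trans (mul_le_one₀ ih (norm_nonneg _) hT)

/-- Mean ergodic theorem for the matrix coefficients of a contraction, without completeness. -/
theorem cauchySeq_average_inner_pow {E : Type*} [NormedAddCommGroup E] [InnerProductSpace ℂ E]
    (T : E →L[ℂ] E) (hT : ‖T‖ ≤ 1) (x y : E) :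
    CauchySeq fun N : ℕ => (N : ℂ)⁻¹ * ∑ n ∈ Finset.range N, ⟪y, (T ^ n) x⟫_ℂ := by
  -- The tensor products used below are only pre-Hilbert, so the ergodic theorem is applied in the
  -- completion.
  let i : E →ₗᵢ[ℂ] UniformSpace.Completion E := UniformSpace.Completion.toComplₗᵢ
  let S : UniformSpace.Completion E →L[ℂ] UniformSpace.Completion E := T.completion
  have hSi (z : E) : S (i z) = i (T z) := ContinuousLinearMap.completion_apply_coe T z
  have hS : ‖S‖ ≤ 1 := by
    refine S.opNorm_le_bound zero_le_one fun z => ?_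
    induction z using UniformSpace.Completion.induction_on with
    | hp => exact isClosed_le (by fun_prop) (by fun_prop)
    | ih z =>
      change ‖S (i z)‖ ≤ 1 * ‖i z‖
      rw [hSi, i.norm_map, i.norm_map]
      exact T.le_of_opNorm_le hT z
  have hiter (n : ℕ) : S^[n] (i x) = i ((T ^ n) x) := by
    induction n with
    | zero => rfl
    | succ n ih => rw [Function.iterate_succ_apply', ih, hSi, pow_succ']; rfl
  have h := (tendsto_const_nhds (x := i y)).inner (𝕜 := ℂ)
    (S.tendsto_birkhoffAverage_orthogonalProjection hS (i x)) |>.cauchySeq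
  refine (congrArg CauchySeq (funext fun N => ?_)).mp h
  simp [birkhoffAverage, birkhoffSum, hiter, inner_smul_right, inner_sum]

/-- Averages of products of matrix coefficients of contractions converge: a product of
coefficients is a coefficient of a tensor product. -/
theorem cauchySeq_average_inner_pow_mul_prod {H : Type*} [NormedAddCommGroup H]
    [InnerProductSpace ℂ H] {U : H →L[ℂ] H} (hU : ‖U‖ ≤ 1) {ι : Type*} (s : Finset ι)
    (u v : ι → H) :
    s.Nonempty → CauchySeq fun N : ℕ => (N : ℂ)⁻¹ *
      ∑ n ∈ Finset.range N, ∏ j ∈ s, ⟪v j, (U ^ n) (u j)⟫_ℂ := by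
  classical
  intro hs
  -- One coefficient is kept apart, for an arbitrary contraction `T`, so that the induction can
  -- absorb the others into `T ⊗ U`.
  suffices key : ∀ (s : Finset ι) (K : Type _) [NormedAddCommGroup K] [InnerProductSpace ℂ K]
      (T : K →L[ℂ] K) (_ : ‖T‖ ≤ 1) (x y : K), CauchySeq fun N : ℕ => (N : ℂ)⁻¹ *
        ∑ n ∈ Finset.range N, ⟪y, (T ^ n) x⟫_ℂ * ∏ j ∈ s, ⟪v j, (U ^ n) (u j)⟫_ℂ by
    obtain ⟨a, ha⟩ := hs
    convert key (s.erase a) H U hU (u a) (v a) using 5 with N n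
    exact (Finset.mul_prod_erase s (fun j => ⟪v j, (U ^ n) (u j)⟫_ℂ) ha).symm
  clear hs s
  intro s
  induction s using Finset.induction_on with
  | empty =>
    intro K _ _ T hT x y
    simpa using cauchySeq_average_inner_pow T hT x y
  | insert a s ha ih =>
    intro K _ _ T hT x y
    have h := ih (K ⊗[ℂ] H) (TensorProduct.mapL T U)
      ((TensorProduct.norm_mapL_le T U).trans (mul_le_one₀ hT (norm_nonneg _) hU))
      (x ⊗ₜ u a) (y ⊗ₜ v a)
    simpa only [TensorProduct.mapL_pow, TensorProduct.mapL_tmul, TensorProduct.inner_tmul,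
      Finset.prod_insert ha, mul_assoc] using h

end Coefficients

/-! ### Finite-rank approximation -/

section Compact

variable {H : Type*} [NormedAddCommGroup H] [InnerProductSpace ℂ H]

/-- The rank-one operators on `H`. -/
def rankOneOperators (H : Type*) [NormedAddCommGroup H] [InnerProductSpace ℂ H] :
    Set (H →L[ℂ] H) :=
  {T | ∃ u v : H, T = rankOne ℂ u v}

/-- Project `A` onto the span of a finite `ε / 2`-net of the image of the unit ball: the projection
is the nearest point, hence at least as close as the net. -/
theorem IsCompactOperator.mem_closure_span_rankOneOperators [CompleteSpace H] {A : H →L[ℂ] H}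
    (hA : IsCompactOperator A) :
    A ∈ (Submodule.span ℂ (rankOneOperators H)).topologicalClosure := by
  rw [← SetLike.mem_coe, Submodule.topologicalClosure_coe, Metric.mem_closure_iff]
  intro ε hε
  have htb : TotallyBounded (A '' Metric.closedBall 0 1) :=
    (hA.isCompact_closure_image_closedBall 1).totallyBounded.subset subset_closure
  obtain ⟨t, ht, hcover⟩ := Metric.totallyBounded_iff.1 htb (ε / 2) (half_pos hε)
  let V : Submodule ℂ H := Submodule.span ℂ t
  have : FiniteDimensional ℂ V := FiniteDimensional.span_of_finite ℂ ht
  refine ⟨V.starProjection ∘L A, ?_, ?_⟩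
  · have hP := (stdOrthonormalBasis ℂ V).starProjection_eq_sum_rankOne
    rw [hP, ContinuousLinearMap.finsetSum_comp]
    refine Submodule.sum_mem _ fun i _ =>
      Submodule.subset_span ⟨_, _, InnerProductSpace.rankOne_comp _ _ _⟩
  · rw [dist_eq_norm]
    refine lt_of_le_of_lt ?_ (half_lt_self hε)
    refine ContinuousLinearMap.opNorm_le_of_unit_norm (half_pos hε).le fun x hx => ?_
    obtain ⟨z, hz, hxz⟩ := Set.mem_iUnion₂.1 (hcover ⟨x, by simp [hx], rfl⟩)
    change ‖A x - V.starProjection (A x)‖ ≤ _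
    rw [Submodule.starProjection_minimal]
    refine (ciInf_le ⟨0, ?_⟩ (⟨z, Submodule.subset_span hz⟩ : V)).trans ?_
    · rintro _ ⟨w, rfl⟩
      positivity
    · rw [← dist_eq_norm]
      exact (Metric.mem_ball.1 hxz).le

end Compact

/-- For uniformly bounded linear maps, the set of points with Cauchy orbits is a closed subspace. -/
theorem cauchySeq_of_mem_closure_span {E F : Type*} [NormedAddCommGroup E] [NormedSpace ℂ E]
    [NormedAddCommGroup F] [NormedSpace ℂ F] (L : ℕ → E →ₗ[ℂ] F) (C : ℝ)
    (hL : ∀ N x, ‖L N x‖ ≤ C * ‖x‖) {s : Set E} (hs : ∀ x ∈ s, CauchySeq fun N => L N x)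
    {x : E} (hx : x ∈ (Submodule.span ℂ s).topologicalClosure) : CauchySeq fun N => L N x := by
  have hspan : ∀ y ∈ Submodule.span ℂ s, CauchySeq fun N => L N y := by
    intro y hy
    induction hy using Submodule.span_induction with
    | mem y hy => exact hs y hy
    | zero => simpa using cauchySeq_const (0 : F)
    | add y z _ _ hy hz =>
      simp only [map_add]
      exact hy.add hz
    | smul c y _ hy =>
      simp only [map_smul]
      exact (uniformContinuous_const_smul c).comp_cauchySeq hy
  rw [← SetLike.mem_coe, Submodule.topologicalClosure_coe, Metric.mem_closure_iff] at hx
  rw [Metric.cauchySeq_iff']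
  intro ε hε
  -- `C` may be zero or negative; `|C| + 1` is safe to divide by.
  have hC : 0 < |C| + 1 := by positivity
  obtain ⟨y, hy, hxy⟩ := hx (ε / 3 / (|C| + 1)) (by positivity)
  have hclose (N : ℕ) : dist (L N x) (L N y) < ε / 3 := by
    rw [dist_eq_norm, ← map_sub]
    rw [dist_eq_norm, lt_div_iff₀ hC] at hxy
    nlinarith [hL N (x - y), le_abs_self C, norm_nonneg (x - y)]
  obtain ⟨N₀, hN₀⟩ := Metric.cauchySeq_iff'.1 (hspan y hy) (ε / 3) (by positivity)
  refine ⟨N₀, fun n hn => ?_⟩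
  have h₁ := dist_triangle4 (L n x) (L n y) (L N₀ y) (L N₀ x)
  have h₂ := hclose n
  have h₃ := hclose N₀
  rw [dist_comm] at h₃
  linarith [hN₀ n hn]

/-! ### Entangled words and means -/

section Word

variable {H : Type*} [NormedAddCommGroup H] [InnerProductSpace ℂ H] {r k : ℕ}

theorem norm_entangledWord_le {U : H →L[ℂ] H} (hU : ‖U‖ ≤ 1) (α : Fin (r + 1) → Fin k)
    (A : Fin r → H →L[ℂ] H) (n : Fin k → ℕ) : ‖entangledWord U α A n‖ ≤ ∏ j, ‖A j‖ := by
  have hprod : ∀ l : List (H →L[ℂ] H), ‖l.prod‖ ≤ (l.map norm).prod := by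
    intro l
    induction l with
    | nil => exact ContinuousLinearMap.norm_id_le
    | cons a l ih =>
      rw [List.prod_cons, List.map_cons, List.prod_cons]
      exact (ContinuousLinearMap.opNorm_comp_le a l.prod).trans
        (mul_le_mul_of_nonneg_left ih (norm_nonneg a))
  refine (ContinuousLinearMap.opNorm_comp_le _ _).trans ?_
  refine (mul_le_of_le_one_left (norm_nonneg _)
    (ContinuousLinearMap.norm_pow_le_one hU _)).trans ((hprod _).trans ?_)
  rw [List.map_ofFn, List.prod_ofFn]
  refine Finset.prod_le_prod (fun _ _ => norm_nonneg _) fun j _ => ?_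
  exact (ContinuousLinearMap.opNorm_comp_le _ _).trans
    (mul_le_of_le_one_right (norm_nonneg _) (ContinuousLinearMap.norm_pow_le_one hU _))

theorem norm_entangledMean_le {U : H →L[ℂ] H} (hU : ‖U‖ ≤ 1) (α : Fin (r + 1) → Fin k)
    (A : Fin r → H →L[ℂ] H) (N : ℕ) : ‖entangledMean U α A N‖ ≤ ∏ j, ‖A j‖ := by
  have hC : 0 ≤ ∏ j, ‖A j‖ := Finset.prod_nonneg fun _ _ => norm_nonneg _
  rw [entangledMean, norm_smul]
  have hsum : ‖∑ n : Fin k → Fin N, entangledWord U α A fun i => (n i : ℕ)‖ ≤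
      (N : ℝ) ^ k * ∏ j, ‖A j‖ := by
    refine (norm_sum_le_of_le _ fun n _ => norm_entangledWord_le hU α A _).trans ?_
    simp
  refine (mul_le_mul_of_nonneg_left hsum (norm_nonneg _)).trans ?_
  rw [← mul_assoc, norm_inv, norm_pow, Complex.norm_natCast]
  -- An inequality, since at `N = 0` the inverse is `0`.
  exact mul_le_of_le_one_left hC inv_mul_le_one

/-- The entangled word as a multilinear map of the operators. -/
noncomputable def entangledWordMultilinear (U : H →L[ℂ] H) (α : Fin (r + 1) → Fin k)
    (n : Fin k → ℕ) : MultilinearMap ℂ (fun _ : Fin r => H →L[ℂ] H) (H →L[ℂ] H) :=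
  (LinearMap.mulLeft ℂ (U ^ n (α 0))).compMultilinearMap
    ((MultilinearMap.mkPiAlgebraFin ℂ r (H →L[ℂ] H)).compLinearMap
      fun j => LinearMap.mulRight ℂ (U ^ n (α j.succ)))

/-- The entangled mean as a multilinear map of the operators. -/
noncomputable def entangledMeanMultilinear (U : H →L[ℂ] H) (α : Fin (r + 1) → Fin k) (N : ℕ) :
    MultilinearMap ℂ (fun _ : Fin r => H →L[ℂ] H) (H →L[ℂ] H) :=
  ((N : ℂ) ^ k)⁻¹ • ∑ n : Fin k → Fin N, entangledWordMultilinear U α fun i => (n i : ℕ)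

theorem entangledMeanMultilinear_apply (U : H →L[ℂ] H) (α : Fin (r + 1) → Fin k)
    (A : Fin r → H →L[ℂ] H) (N : ℕ) :
    entangledMeanMultilinear U α N A = entangledMean U α A N := by
  simp [entangledMeanMultilinear, entangledMean, entangledWordMultilinear, entangledWord]

/-- Each rank-one operator cuts the word: its `v` closes the factor on its left and its `u` opens
the one on its right, hence the shifts by `Fin.cons` and `Fin.snoc`. -/
theorem inner_alternating_prod_rankOne (U : H →L[ℂ] H) (x y : H) (u v : Fin r → H)
    (e : Fin (r + 1) → ℕ) :
    ⟪y, (U ^ e 0 * (List.ofFn fun j : Fin r => rankOne ℂ (u j) (v j) * U ^ e j.succ).prod) x⟫_ℂ =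
      ∏ i, ⟪(Fin.cons y v : Fin (r + 1) → H) i,
        (U ^ e i) ((Fin.snoc u x : Fin (r + 1) → H) i)⟫_ℂ := by
  -- Removing the first factor replaces `y` by `v 0`.
  induction r generalizing y with
  | zero => simp [Fin.snoc]
  | succ r ih =>
    have h := ih (v 0) (fun j => u j.succ) (fun j => v j.succ) (fun j => e j.succ)
    rw [Fin.prod_univ_succ]
    simp only [Fin.cons_zero, Fin.cons_succ]
    have h0 : (Fin.snoc u x : Fin (r + 2) → H) 0 = u 0 := Fin.snoc_castSucc (α := fun _ => H) x u 0
    have hs (i : Fin (r + 1)) : (Fin.snoc u x : Fin (r + 2) → H) i.succ =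
        (Fin.snoc (fun j => u j.succ) x : Fin (r + 1) → H) i := by
      induction i using Fin.lastCases with
      | last => rw [Fin.succ_last, Fin.snoc_last, Fin.snoc_last]
      | cast i => rw [Fin.succ_castSucc, Fin.snoc_castSucc, Fin.snoc_castSucc]
    have hv : (Fin.cons (v 0) fun j => v j.succ : Fin (r + 1) → H) = v := Fin.cons_self_tail v
    rw [hv] at h
    simp only [h0, hs, ← h, List.ofFn_succ, List.prod_cons, mul_assoc,
      mul_apply_eq_comp, InnerProductSpace.rankOne_apply, map_smul, inner_smul_right]
    exact mul_comm _ _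

/-- After grouping by fibres of `α`, each variable occurs in one factor only, so the sum over the
box is a product of sums. -/
theorem inner_entangledMean_rankOne (U : H →L[ℂ] H) (α : Fin (r + 1) → Fin k) (u v : Fin r → H)
    (x y : H) (N : ℕ) :
    ⟪y, entangledMean U α (fun j => rankOne ℂ (u j) (v j)) N x⟫_ℂ =
      ∏ l : Fin k, ((N : ℂ)⁻¹ * ∑ n ∈ Finset.range N, ∏ i with α i = l,
        ⟪(Fin.cons y v : Fin (r + 1) → H) i,
          (U ^ n) ((Fin.snoc u x : Fin (r + 1) → H) i)⟫_ℂ) := by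
  have hword (n : Fin k → ℕ) : ⟪y, entangledWord U α (fun j => rankOne ℂ (u j) (v j)) n x⟫_ℂ =
      ∏ l : Fin k, ∏ i with α i = l, ⟪(Fin.cons y v : Fin (r + 1) → H) i,
          (U ^ n l) ((Fin.snoc u x : Fin (r + 1) → H) i)⟫_ℂ := by
    rw [entangledWord, inner_alternating_prod_rankOne U x y u v fun i => n (α i),
      ← Finset.prod_fiberwise Finset.univ α]
    refine Finset.prod_congr rfl fun l _ => Finset.prod_congr rfl fun i hi => ?_
    rw [(Finset.mem_filter.1 hi).2]
  simp only [entangledMean, smul_apply, sum_apply,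
    inner_smul_right, inner_sum, hword, Finset.prod_mul_distrib, Finset.prod_const,
    Finset.card_univ, Fintype.card_fin, inv_pow, Finset.sum_range]
  rw [Finset.prod_univ_sum, Fintype.piFinset_univ]

theorem cauchySeq_inner_entangledMean {U : H →L[ℂ] H} [CompleteSpace H] (hU : ‖U‖ ≤ 1)
    {α : Fin (r + 1) → Fin k} (hα : Function.Surjective α) {A : Fin r → H →L[ℂ] H}
    (hA : ∀ j, IsCompactOperator (A j)) (x y : H) :
    CauchySeq fun N => ⟪y, entangledMean U α A N x⟫_ℂ := by
  classical
  -- Slots pass from rank one to compact one at a time; `s` holds the slots allowed to be compact.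
  suffices key : ∀ (s : Finset (Fin r)) (A : Fin r → H →L[ℂ] H),
      (∀ j ∈ s, IsCompactOperator (A j)) → (∀ j ∉ s, A j ∈ rankOneOperators H) →
      CauchySeq fun N => ⟪y, entangledMean U α A N x⟫_ℂ from
    key Finset.univ A (fun j _ => hA j) fun j hj => absurd (Finset.mem_univ j) hj
  clear hA A
  intro s
  induction s using Finset.induction_on with
  | empty =>
    intro A _ hA
    choose u v huv using fun j => hA j (Finset.notMem_empty j)
    obtain rfl : A = fun j => rankOne ℂ (u j) (v j) := funext huv
    simp only [inner_entangledMean_rankOne]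
    have hfactor (l : Fin k) := cauchySeq_tendsto_of_complete
      (cauchySeq_average_inner_pow_mul_prod hU (Finset.univ.filter (α · = l))
        (Fin.snoc u x : Fin (r + 1) → H) (Fin.cons y v : Fin (r + 1) → H)
        ((hα l).imp fun i hi => by simp [hi]))
    choose c hc using hfactor
    exact (tendsto_finsetProd Finset.univ fun l _ => hc l).cauchySeq
  | insert a s ha ih =>
    intro A hcpt hrank
    let L (N : ℕ) : (H →L[ℂ] H) →ₗ[ℂ] ℂ :=
      (innerSL ℂ y ∘L ContinuousLinearMap.apply ℂ H x).toLinearMap ∘ₗ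
        (entangledMeanMultilinear U α N).toLinearMap A a
    have hLapply (N : ℕ) (B : H →L[ℂ] H) :
        L N B = ⟪y, entangledMean U α (Function.update A a B) N x⟫_ℂ := by
      simp [L, entangledMeanMultilinear_apply]
    have hbound (N : ℕ) (B : H →L[ℂ] H) :
        ‖L N B‖ ≤ (‖y‖ * (∏ j ∈ Finset.univ.erase a, ‖A j‖) * ‖x‖) * ‖B‖ := by
      have h := norm_entangledMean_le hU α (Function.update A a B) N
      rw [← Finset.mul_prod_erase _ _ (Finset.mem_univ a), Function.update_self,
        Finset.prod_congr rfl fun j hj => by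
          rw [Function.update_of_ne (Finset.ne_of_mem_erase hj)]] at h
      calc ‖L N B‖ ≤ ‖y‖ * ‖entangledMean U α (Function.update A a B) N x‖ := by
            rw [hLapply]; exact norm_inner_le_norm _ _
        _ ≤ ‖y‖ * ((‖B‖ * ∏ j ∈ Finset.univ.erase a, ‖A j‖) * ‖x‖) := by
            gcongr; exact ContinuousLinearMap.le_of_opNorm_le _ h x
        _ = _ := by ring
    have hL := cauchySeq_of_mem_closure_span L _ hbound (s := rankOneOperators H) ?_
      (hcpt a (Finset.mem_insert_self a s)).mem_closure_span_rankOneOperators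
    · simpa only [hLapply, Function.update_eq_self] using hL
    · intro B hB
      simp only [hLapply]
      refine ih _ (fun j hj => ?_) fun j hj => ?_
      · rw [Function.update_of_ne (ne_of_mem_of_not_mem hj ha)]
        exact hcpt j (Finset.mem_insert_of_mem hj)
      · obtain rfl | hja := eq_or_ne j a
        · rwa [Function.update_self]
        · rw [Function.update_of_ne hja]
          exact hrank j (by simp [hja, hj])

end Word

/-- A bounded sequence of operators whose matrix elements converge converges weakly. -/
theorem exists_tendsto_WOT_of_cauchySeq_inner {H : Type*} [NormedAddCommGroup H]
    [InnerProductSpace ℂ H] [CompleteSpace H] (M : ℕ → H →L[ℂ] H) (C : ℝ) (hM : ∀ N, ‖M N‖ ≤ C)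
    (h : ∀ x y, CauchySeq fun N => ⟪y, M N x⟫_ℂ) :
    ∃ S : H →L[ℂ] H, Tendsto (fun N => (ContinuousLinearMapWOT.ofCLM (M N) : H →WOT[ℂ] H))
      atTop (𝓝 (ContinuousLinearMapWOT.ofCLM S)) := by
  choose b hb using fun x y => cauchySeq_tendsto_of_complete (h x y)
  let B : H →L⋆[ℂ] H →L[ℂ] ℂ := LinearMap.mkContinuous₂
    (LinearMap.mk₂'ₛₗ (starRingEnd ℂ) (RingHom.id ℂ) (fun y x => b x y)
      (fun y z x => tendsto_nhds_unique (hb x (y + z))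
        (by simpa only [inner_add_left] using (hb x y).add (hb x z)))
      (fun c y x => tendsto_nhds_unique (hb x (c • y))
        (by simpa only [inner_smul_left, smul_eq_mul] using (hb x y).const_mul _))
      (fun y x z => tendsto_nhds_unique (hb (x + z) y)
        (by simpa only [map_add, inner_add_right] using (hb x y).add (hb z y)))
      (fun c y x => tendsto_nhds_unique (hb (c • x) y)
        (by simpa only [map_smul, inner_smul_right, smul_eq_mul, RingHom.id_apply]
          using (hb x y).const_mul _)))
    C fun y x => by
      refine le_of_tendsto (hb x y).norm (Eventually.of_forall fun N => ?_)
      calc ‖⟪y, M N x⟫_ℂ‖ ≤ ‖y‖ * ‖M N x‖ := norm_inner_le_norm _ _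
        _ ≤ ‖y‖ * (C * ‖x‖) := by gcongr; exact (M N).le_of_opNorm_le (hM N) x
        _ = C * ‖y‖ * ‖x‖ := by ring
  -- The operator representing `B` acts on `y`, in the conjugate-linear slot; its adjoint acts on
  -- `x`.
  refine ⟨ContinuousLinearMap.adjoint (InnerProductSpace.continuousLinearMapOfBilin B), ?_⟩
  rw [ContinuousLinearMapWOT.tendsto_iff_forall_inner_apply_tendsto]
  intro x y
  have hS : ⟪y, ContinuousLinearMap.adjoint (InnerProductSpace.continuousLinearMapOfBilin B) x⟫_ℂ
      = b x y := by
    rw [ContinuousLinearMap.adjoint_inner_right,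
      InnerProductSpace.continuousLinearMapOfBilin_apply]
    rfl
  change Tendsto (fun N => ⟪y, M N x⟫_ℂ) atTop (𝓝 ⟪y, ContinuousLinearMap.adjoint
    (InnerProductSpace.continuousLinearMapOfBilin B) x⟫_ℂ)
  rw [hS]
  exact hb x y

theorem theorem2p1 {H : Type*} [NormedAddCommGroup H] [InnerProductSpace ℂ H] [CompleteSpace H]
    (U : unitary (H →L[ℂ] H)) {r k : ℕ}
    (α : Fin (r + 1) → Fin k) (hα : Function.Surjective α)
    (A : Fin r → H →L[ℂ] H) (hA : ∀ j, IsCompactOperator (A j)) :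
    ∃ S : H →L[ℂ] H,
      Tendsto (fun N : ℕ =>
          (ContinuousLinearMapWOT.ofCLM (entangledMean (U : H →L[ℂ] H) α A N) : H →WOT[ℂ] H))
        atTop (𝓝 (ContinuousLinearMapWOT.ofCLM S)) := by
  have hU : ‖(U : H →L[ℂ] H)‖ ≤ 1 :=
    ContinuousLinearMap.opNorm_le_bound _ zero_le_one fun x => by
      rw [one_mul]
      exact (ContinuousLinearMap.norm_map_of_mem_unitary U.2 x).le
  exact exists_tendsto_WOT_of_cauchySeq_inner _ _ (norm_entangledMean_le hU α A)
    (cauchySeq_inner_entangledMean hU hα hA)
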